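/- Let $\mathbb N=\{1,2,3,\dots\}$. For $\alpha\in\mathbb R$ let $\phi_\alpha,\psi_\alpha:\mathbb R\to\mathbb R$ be given by $\phi_\alpha(x)=|x|^\alpha$ and $\psi_\alpha(x)=\operatorname{sgn}(x)|x|^\alpha$ for $x\neq 0$, and $\phi_\alpha(0)=\psi_\alpha(0)=0$. For a Hermitian matrix $A=UDU^*$ with $U$ unitary and $D=\operatorname{diag}(d_1,\dots,d_m)$ real, and $f:\mathbb R\to\mathbb R$, put $f(A)=U\operatorname{diag}(f(d_1),\dots,f(d_m))U^*$. For a block matrix $H=(H_{st})_{s,t=1}^n$ with $m\times m$ Hermitian blocks $H_{st}$, put $f^{[m]}[H]=(f(H_{st}))_{s,t=1}^n$. **Theorem.** Let $\alpha\in\mathbb R\setminus\{0\}$ and let $m,n\ge 2$ be integers. 1. The matrix $\phi_\alpha^{[m]}[H]$ is positive semidefinite for every positive semidefinite complex $mn\times mn$ matrix $H=(H_{st})_{s,t=1}^n$ whose $m\times m$ blocks $H_{st}$ are Hermitian and pairwise commute, if and only if $\alpha\in 2\mathbb N\cup[n-2,\infty)$. Moreover, if $\alpha\notin 2\mathbb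 N\cup[n-2,\infty)$, there exist pairwise commuting real symmetric $m\times m$ matrices $H_{st}$ $(1\le s,t\le n)$ such that $H=(H_{st})$ is positive semidefinite but $\phi_\alpha^{[m]}[H]$ is not. 2. The matrix $\psi_\alpha^{[m]}[H]$ is positive semidefinite for every positive semidefinite complex $mn\times mn$ matrix $H=(H_{st})_{s,t=1}^n$ whose $m\times m$ blocks $H_{st}$ are Hermitian and pairwise commute, if and only if $\alpha\in(-1+2\mathbb N)\cup[n-2,\infty)$. Moreover, if $\alpha\notin(-1+2\mathbb N)\cup[n-2,\infty)$, there exist pairwise commuting real symmetric $m\times m$ matrices $H_{st}$ $(1\le s,t\le n)$ such that $H=(H_{st})$ is positive semidefinite but $\psi_\alpha^{[m]}[H]$ is not. -/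

import Mathlib

open scoped ComplexOrder

/-- Even extension to the real line of the power function `x ↦ x ^ α`, with value `0` at `0`. -/
noncomputable def phi (α : ℝ) (x : ℝ) : ℝ :=
  if x = 0 then 0 else |x| ^ α

/-- Odd extension to the real line of the power function `x ↦ x ^ α`, with value `0` at `0`. -/
noncomputable def psi (α : ℝ) (x : ℝ) : ℝ :=
  if x = 0 then 0 else Real.sign x * |x| ^ α

/-- The functional calculus applied to every block: block `(s, t)` of `blockMap f H` is `f (H s t)`.
For a Hermitian block `A = U D U*` (`U` unitary, `D` real diagonal) Mathlib's `cfc f A` is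
`U f(D) U*`, for an arbitrary function `f`, since the spectrum is finite
(see `blockMap_apply_of_isHermitian`). -/
noncomputable def blockMap {𝕜 : Type*} [RCLike 𝕜] {n m : ℕ} (f : ℝ → ℝ)
    (H : Matrix (Fin n) (Fin n) (Matrix (Fin m) (Fin m) 𝕜)) :
    Matrix (Fin n) (Fin n) (Matrix (Fin m) (Fin m) 𝕜) :=
  Matrix.of fun s t => cfc f (H s t)

theorem blockMap_apply_of_isHermitian {𝕜 : Type*} [RCLike 𝕜] {n m : ℕ} (f : ℝ → ℝ)
    (H : Matrix (Fin n) (Fin n) (Matrix (Fin m) (Fin m) 𝕜)) (s t : Fin n)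
    (h : (H s t).IsHermitian) :
    blockMap f H s t = (h.eigenvectorUnitary : Matrix (Fin m) (Fin m) 𝕜) *
      Matrix.diagonal (fun i => ((f (h.eigenvalues i) : ℝ) : 𝕜)) *
      star (h.eigenvectorUnitary : Matrix (Fin m) (Fin m) 𝕜) := by
  rw [blockMap, Matrix.of_apply, h.cfc_eq, Matrix.IsHermitian.cfc, Unitary.conjStarAlgAut_apply]
  rfl

/-- The `mn × mn` matrix obtained from an `n × n` array of `m × m` blocks; the row `(s, i)` is
row `i` of block row `s`. -/
def flatten {𝕜 : Type*} {n m : ℕ}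
    (H : Matrix (Fin n) (Fin n) (Matrix (Fin m) (Fin m) 𝕜)) :
    Matrix (Fin n × Fin m) (Fin n × Fin m) 𝕜 :=
  Matrix.comp (Fin n) (Fin n) (Fin m) (Fin m) 𝕜 H

/-- Every block is Hermitian (real symmetric when `𝕜 = ℝ`) and any two blocks commute. -/
def HermitianCommutingBlocks {𝕜 : Type*} [RCLike 𝕜] {n m : ℕ}
    (H : Matrix (Fin n) (Fin n) (Matrix (Fin m) (Fin m) 𝕜)) : Prop :=
  (∀ s t, (H s t).IsHermitian) ∧ ∀ s t u v, Commute (H s t) (H u v)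

/-- The set `2ℕ ∪ [n - 2, ∞)` with `ℕ = {1, 2, 3, …}`. -/
def phiPowers (n : ℕ) : Set ℝ :=
  {α | ∃ k : ℕ, 1 ≤ k ∧ α = 2 * (k : ℝ)} ∪ Set.Ici ((n : ℝ) - 2)

/-- The set `(-1 + 2ℕ) ∪ [n - 2, ∞)` with `ℕ = {1, 2, 3, …}`. -/
def psiPowers (n : ℕ) : Set ℝ :=
  {α | ∃ k : ℕ, 1 ≤ k ∧ α = -1 + 2 * (k : ℝ)} ∪ Set.Ici ((n : ℝ) - 2)

/-!
Commuting Hermitian blocks are simultaneously diagonalizable by a unitary, so the block problem is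
equivalent, for every `m ≥ 1` and over `ℝ` as well as over `ℂ`, to the scalar one: which `φ_α` and
`ψ_α`, applied entrywise, preserve positive semidefiniteness of real `n × n` matrices?

Sufficiency follows FitzGerald and Horn. Even, resp. odd, natural powers are Hadamard powers. For
`α > n - 2`, split off a rank one matrix, `A = zzᵀ + B` with `B ≥ 0` vanishing in one row and
column. Along `M t = zzᵀ + t B` the entrywise image `φ_α[M t]` has derivative
`α ψ_{α - 1}[M t] ∘ B`, which is positive semidefinite by induction on `n` because only an
`(n - 1) × (n - 1)` block survives, while `φ_α[zzᵀ] = φ_α(z) φ_α(z)ᵀ`; the same holds with `φ` and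
`ψ` exchanged. The endpoint `α = n - 2` is a limit.

For necessity, test on `𝟙𝟙ᵀ + ε y yᵀ` with `N + 1` distinct nodes `y i`, against the vector of their
Lagrange nodal weights, which annihilates all powers below the `N`-th. As `ε → 0` this yields Horn's
condition `f⁽ᴺ⁾(1) ≥ 0` for `N < n`, violated by every `α < n - 2` that is not a natural number. For
natural `p ≤ n - 3` of the wrong parity (and `p ≠ 0` in the case of `φ`), the function is `x ^ p` on
the positive axis and `-x ^ p` on the negative one. A Gram matrix whose entries are positive outside
one row and column, where they are nodes of both signs, then has an image for which the nodal
weights form a null vector of the quadratic form that is not in the kernel.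
-/

open Matrix Filter Topology

section PosSemidef

variable {ι κ 𝕜 : Type*} [RCLike 𝕜]

theorem exists_eq_gram_of_posSemidef [Finite ι] {A : Matrix ι ι 𝕜} (hA : A.PosSemidef) :
    ∃ (k : ℕ) (v : ι → EuclideanSpace 𝕜 (Fin k)), A = gram 𝕜 v := by
  have := Fintype.ofFinite ι
  obtain ⟨k, w, rfl⟩ := posSemidef_iff_eq_sum_vecMulVec.mp hA
  refine ⟨k, fun i => WithLp.toLp 2 fun l => star (w l i), ?_⟩
  ext i j
  simp [Matrix.sum_apply, vecMulVec_apply, gram_apply, PiLp.inner_apply, mul_comm]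

theorem exists_eq_vecMulVec_add_of_posSemidef [Finite ι] {A : Matrix ι ι 𝕜} (hA : A.PosSemidef)
    (i₀ : ι) :
    ∃ (z : ι → 𝕜) (B : Matrix ι ι 𝕜),
      B.PosSemidef ∧ (∀ i, B i₀ i = 0) ∧ A = vecMulVec (star z) z + B := by
  obtain ⟨k, v, rfl⟩ := exists_eq_gram_of_posSemidef hA
  -- `u` is the unit vector in the direction of `v i₀`, or zero if `v i₀ = 0`.
  set u : EuclideanSpace 𝕜 (Fin k) := (‖v i₀‖⁻¹ : 𝕜) • v i₀ with hu
  have proj_self : inner 𝕜 u (v i₀) • u = v i₀ := by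
    by_cases h : v i₀ = 0
    · simp [h]
    · have norm_ne : (‖v i₀‖ : 𝕜) ≠ 0 := by simpa using h
      rw [hu, inner_smul_left, inner_self_eq_norm_sq_to_K, smul_smul, map_inv₀, RCLike.conj_ofReal]
      convert one_smul 𝕜 (v i₀)
      field_simp
  have mul_inner_self (x) : inner 𝕜 u x * inner 𝕜 u u = inner 𝕜 u x := by
    by_cases h : v i₀ = 0
    · simp [hu, h]
    · simp [hu, inner_self_eq_norm_sq_to_K, h]
  refine ⟨fun i => inner 𝕜 u (v i), gram 𝕜 fun i => v i - inner 𝕜 u (v i) • u,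
    posSemidef_gram 𝕜 _, fun i => ?_, ?_⟩
  · rw [gram_apply, proj_self, sub_self, inner_zero_left]
  · ext i j
    simp only [gram_apply, Matrix.add_apply, vecMulVec_apply, Pi.star_apply, RCLike.star_def,
      inner_sub_left, inner_sub_right, inner_smul_left, inner_smul_right, inner_conj_symm]
    linear_combination -inner 𝕜 (v i) u * mul_inner_self (v j)

theorem posSemidef_of_submatrix_some [Finite ι] {A : Matrix (Option ι) (Option ι) 𝕜}
    (hA : (A.submatrix some some).PosSemidef) (hrow : ∀ i, A none i = 0)
    (hcol : ∀ i, A i none = 0) : A.PosSemidef := by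
  obtain ⟨k, v, hv⟩ := exists_eq_gram_of_posSemidef hA
  convert posSemidef_gram 𝕜 fun o : Option ι => o.elim 0 v
  ext (_ | i) (_ | j)
  · simp [hrow, gram_apply]
  · simp [hrow, gram_apply]
  · simp [hcol, gram_apply]
  · exact congrFun₂ hv i j

theorem isClosed_setOf_posSemidef [Finite ι] : IsClosed {A : Matrix ι ι 𝕜 | A.PosSemidef} := by
  have := Fintype.ofFinite ι
  simp only [posSemidef_iff_dotProduct_mulVec, Set.ofPred_and, Set.ofPred_forall]
  refine (isClosed_eq (by fun_prop) continuous_id).inter (isClosed_iInter fun x => ?_)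
  exact isClosed_le continuous_const (by fun_prop)

theorem posSemidef_iff_sum_sum_nonneg [Fintype ι] {A : Matrix ι ι ℝ} :
    A.PosSemidef ↔ A.IsHermitian ∧ ∀ x : ι → ℝ, 0 ≤ ∑ i, ∑ j, x i * x j * A i j := by
  simp only [posSemidef_iff_dotProduct_mulVec, dotProduct, mulVec, Finset.mul_sum, Pi.star_apply,
    star_trivial, mul_comm (A _ _), mul_assoc]

theorem posSemidef_map_ofReal_iff [Finite ι] {A : Matrix ι ι ℝ} :
    (A.map ((↑) : ℝ → 𝕜)).PosSemidef ↔ A.PosSemidef := by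
  have := Fintype.ofFinite ι
  constructor
  · intro h
    refine posSemidef_iff_sum_sum_nonneg.mpr ⟨?_, fun x => ?_⟩
    · exact .ext fun i j => by simpa using h.isHermitian.apply i j
    · have quad_nonneg := h.re_dotProduct_nonneg fun i => (x i : 𝕜)
      simpa [dotProduct, mulVec, Finset.mul_sum, mul_comm (A _ _), mul_assoc] using quad_nonneg
  · intro h
    obtain ⟨k, v, rfl⟩ := exists_eq_gram_of_posSemidef h
    convert posSemidef_gram 𝕜 fun i => WithLp.toLp 2 fun l => (v i l : 𝕜)
    ext i j
    simp [gram_apply, PiLp.inner_apply]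

theorem posSemidef_blockDiagonal_iff [Finite ι] [Finite κ] [DecidableEq κ] {A : κ → Matrix ι ι 𝕜} :
    (blockDiagonal A).PosSemidef ↔ ∀ k, (A k).PosSemidef := by
  constructor
  · intro h k
    convert h.submatrix fun i => (i, k)
    ext i j
    simp
  · intro h
    have := Fintype.ofFinite κ
    have eq_sum : blockDiagonal A = ∑ k, kroneckerMap (· * ·) (A k) (diagonal (Pi.single k 1)) := by
      ext ⟨i, k⟩ ⟨j, l⟩
      simp [Matrix.sum_apply, blockDiagonal_apply, diagonal_apply, Pi.single_apply]
    rw [eq_sum]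
    exact posSemidef_sum _ fun k _ =>
      (h k).kronecker (.diagonal (Pi.single_nonneg.mpr zero_le_one))

theorem posSemidef_fin_two_iff {A : Matrix (Fin 2) (Fin 2) ℝ} :
    A.PosSemidef ↔ A.IsHermitian ∧ 0 ≤ A 0 0 ∧ 0 ≤ A 1 1 ∧ A 0 1 ^ 2 ≤ A 0 0 * A 1 1 := by
  have symm (h : A.IsHermitian) : A 1 0 = A 0 1 := by simpa using (h.apply 1 0).symm
  constructor
  · intro h
    have det_nonneg := h.det_nonneg
    rw [det_fin_two, symm h.isHermitian] at det_nonneg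
    exact ⟨h.isHermitian, h.diag_nonneg, h.diag_nonneg, by linarith⟩
  · rintro ⟨h, ha, hc, hdet⟩
    refine posSemidef_iff_sum_sum_nonneg.mpr ⟨h, fun x => ?_⟩
    simp only [Fin.sum_univ_two, symm h]
    rcases ha.eq_or_lt with ha | ha
    · have hb : A 0 1 = 0 := by
        rw [← ha, zero_mul] at hdet
        simpa using hdet
      simp only [← ha, hb]
      nlinarith [mul_nonneg (sq_nonneg (x 1)) hc]
    · refine nonneg_of_mul_nonneg_right ?_ ha
      nlinarith [sq_nonneg (A 0 0 * x 0 + A 0 1 * x 1),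
        mul_nonneg (sq_nonneg (x 1)) (sub_nonneg.mpr hdet)]

theorem posSemidef_of_hasDerivAt [Finite ι] {M M' : ℝ → Matrix ι ι ℝ} {a b : ℝ} (hab : a ≤ b)
    (hM : ∀ t ∈ Set.Icc a b, ∀ i j, HasDerivAt (fun s => M s i j) (M' t i j) t)
    (hM' : ∀ t ∈ Set.Icc a b, (M' t).PosSemidef) (ha : (M a).PosSemidef)
    (hb : (M b).IsHermitian) : (M b).PosSemidef := by
  have := Fintype.ofFinite ι
  refine posSemidef_iff_sum_sum_nonneg.mpr ⟨hb, fun x => ?_⟩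
  have deriv_quadForm {t} (ht : t ∈ Set.Icc a b) :
      HasDerivAt (fun s => ∑ i, ∑ j, x i * x j * M s i j) (∑ i, ∑ j, x i * x j * M' t i j) t :=
    .fun_sum fun i _ => .fun_sum fun j _ => (hM t ht i j).const_mul _
  have monotone_quadForm : MonotoneOn (fun s => ∑ i, ∑ j, x i * x j * M s i j) (Set.Icc a b) :=
    monotoneOn_of_hasDerivWithinAt_nonneg (convex_Icc a b)
      (fun t ht => (deriv_quadForm ht).continuousAt.continuousWithinAt)
      (fun t ht => (deriv_quadForm (interior_subset ht)).hasDerivWithinAt)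
      fun t ht => (posSemidef_iff_sum_sum_nonneg.mp (hM' t (interior_subset ht))).2 x
  exact ((posSemidef_iff_sum_sum_nonneg.mp ha).2 x).trans
    (monotone_quadForm (Set.left_mem_Icc.mpr hab) (Set.right_mem_Icc.mpr hab) hab)

end PosSemidef

/-- `EntrywisePreserver f ι` says that applying `f` to every entry of a positive semidefinite real
matrix indexed by `ι` yields a positive semidefinite matrix. -/
def EntrywisePreserver (f : ℝ → ℝ) (ι : Type*) : Prop :=
  ∀ A : Matrix ι ι ℝ, A.PosSemidef → (A.map f).PosSemidef

namespace EntrywisePreserver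

variable {ι κ : Type*} {f g : ℝ → ℝ}

theorem of_injective [Finite ι] [Finite κ] (hf : EntrywisePreserver f κ) {e : ι → κ}
    (he : Function.Injective e) : EntrywisePreserver f ι := by
  intro A hA
  obtain ⟨k, v, rfl⟩ := exists_eq_gram_of_posSemidef hA
  have extended := (hf _ (posSemidef_gram ℝ (Function.extend e v 0))).submatrix e
  have gram_eq : (gram ℝ (Function.extend e v 0)).submatrix e e = gram ℝ v := by
    ext i j
    simp [gram_apply, he.extend_apply]
  rwa [← gram_eq]

theorem of_tendsto [Finite ι] {τ : Type*} {l : Filter τ} [l.NeBot] {F : τ → ℝ → ℝ}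
    (hF : ∀ᶠ t in l, EntrywisePreserver (F t) ι)
    (hlim : ∀ x, Tendsto (fun t => F t x) l (𝓝 (f x))) : EntrywisePreserver f ι := by
  intro A hA
  have tendsto_map : Tendsto (fun t => A.map (F t)) l (𝓝 (A.map f)) :=
    tendsto_pi_nhds.mpr fun _ => tendsto_pi_nhds.mpr fun _ => hlim _
  exact isClosed_setOf_posSemidef.mem_of_tendsto tendsto_map (hF.mono fun _ ht => ht A hA)

theorem mul (hf : EntrywisePreserver f ι) (hg : EntrywisePreserver g ι) :
    EntrywisePreserver (f * g) ι := fun A hA => (hf A hA).hadamard (hg A hA)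

theorem pow [Finite ι] (k : ℕ) : EntrywisePreserver (fun x => x ^ k) ι := by
  induction k with
  | zero =>
    intro A _
    convert posSemidef_vecMulVec_self_star (1 : ι → ℝ)
    ext i j
    simp [vecMulVec_apply]
  | succ k ih => exact ih.mul fun _ hA => hA

theorem fin_two (hmul : ∀ x y, f (x * y) = f x * f y) (hmono : MonotoneOn f (Set.Ici 0)) :
    EntrywisePreserver f (Fin 2) := by
  have nonneg {x : ℝ} (hx : 0 ≤ x) : 0 ≤ f x := by
    rw [← Real.mul_self_sqrt hx, hmul]
    exact mul_self_nonneg _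
  intro A hA
  obtain ⟨hherm, h₀, h₁, hdet⟩ := posSemidef_fin_two_iff.mp hA
  refine posSemidef_fin_two_iff.mpr ⟨hherm.map f fun _ => rfl, nonneg h₀, nonneg h₁, ?_⟩
  calc f (A 0 1) ^ 2 = f (A 0 1 ^ 2) := by rw [sq, sq, hmul]
    _ ≤ f (A 0 0 * A 1 1) := hmono (sq_nonneg (A 0 1)) (mul_nonneg h₀ h₁) hdet
    _ = f (A 0 0) * f (A 1 1) := hmul _ _

theorem option_of_hasDerivAt [Finite ι] {c : ℝ} (hc : 0 ≤ c) (hg : EntrywisePreserver g ι)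
    (hfg : ∀ x, HasDerivAt f (c * g x) x) (hmul : ∀ x y, f (x * y) = f x * f y) :
    EntrywisePreserver f (Option ι) := by
  intro A hA
  obtain ⟨z, B, hB, B_none, A_eq⟩ := exists_eq_vecMulVec_add_of_posSemidef hA none
  have B_none' (i) : B i none = 0 := by simpa [B_none] using (hB.isHermitian.apply i none).symm
  let M (t : ℝ) : Matrix (Option ι) (Option ι) ℝ := vecMulVec (star z) z + t • B
  have M_one : M 1 = A := by simp [M, A_eq]
  rw [← M_one]
  refine posSemidef_of_hasDerivAt (M := fun t => (M t).map f)
    (M' := fun t => c • (M t).map g ⊙ B) zero_le_one ?_ ?_ ?_ ?_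
  · intro t _ i j
    have deriv_entry : HasDerivAt (fun s => M s i j) (B i j) t := by
      simpa [M] using ((hasDerivAt_id t).mul_const (B i j)).const_add (vecMulVec (star z) z i j)
    simpa [hadamard_apply, mul_assoc, Function.comp_def] using (hfg (M t i j)).comp t deriv_entry
  · intro t ht
    have M_pos : (M t).PosSemidef := (posSemidef_vecMulVec_star_self z).add (hB.smul ht.1)
    refine .smul (posSemidef_of_submatrix_some ?_ (by simp [B_none]) (by simp [B_none'])) hc
    exact (hg _ (M_pos.submatrix some)).hadamard (hB.submatrix some)
  · convert posSemidef_vecMulVec_star_self fun i => f (z i)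
    ext i j
    simp [M, vecMulVec_apply, hmul]
  · rw [M_one]
    exact hA.isHermitian.map f fun _ => rfl

end EntrywisePreserver

section SignedPowers

variable {α x : ℝ}

theorem phi_eq_abs_rpow (hα : α ≠ 0) (x : ℝ) : phi α x = |x| ^ α := by
  by_cases hx : x = 0 <;> simp [phi, hx, hα]

theorem psi_eq_abs_rpow_mul (α x : ℝ) : psi α x = |x| ^ (α - 1) * x := by
  by_cases hx : x = 0
  · simp [psi, hx]
  · have sign_eq : Real.sign x = x / |x| := by
      rcases lt_or_gt_of_ne hx with h | h
      · rw [Real.sign_of_neg h, abs_of_neg h, div_neg_self hx]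
      · rw [Real.sign_of_pos h, abs_of_pos h, div_self hx]
    rw [psi, if_neg hx, sign_eq, Real.rpow_sub_one (abs_ne_zero.mpr hx)]
    ring

theorem phi_of_pos (hx : 0 < x) : phi α x = x ^ α := by simp [phi, hx.ne', abs_of_pos hx]

theorem psi_eq_phi_of_nonneg (hx : 0 ≤ x) : psi α x = phi α x := by
  rcases hx.eq_or_lt with rfl | hx
  · simp [psi, phi]
  · simp [psi, phi, Real.sign_of_pos hx]

theorem psi_of_pos (hx : 0 < x) : psi α x = x ^ α := by
  rw [psi_eq_phi_of_nonneg hx.le, phi_of_pos hx]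

theorem phi_neg (α x : ℝ) : phi α (-x) = phi α x := by simp [phi]

theorem psi_neg (α x : ℝ) : psi α (-x) = -psi α x := by simp [psi_eq_abs_rpow_mul]

theorem phi_mul (α x y : ℝ) : phi α (x * y) = phi α x * phi α y := by
  by_cases hx : x = 0
  · simp [phi, hx]
  by_cases hy : y = 0
  · simp [phi, hy]
  simp [phi, hx, hy, abs_mul, Real.mul_rpow]

theorem psi_mul (α x y : ℝ) : psi α (x * y) = psi α x * psi α y := by
  simp only [psi_eq_abs_rpow_mul, abs_mul, Real.mul_rpow (abs_nonneg x) (abs_nonneg y)]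
  ring

theorem monotoneOn_phi (hα : 0 < α) : MonotoneOn (phi α) (Set.Ici 0) := by
  intro x hx y _ hxy
  rw [phi_eq_abs_rpow hα.ne', phi_eq_abs_rpow hα.ne']
  gcongr

theorem monotoneOn_psi (hα : 0 < α) : MonotoneOn (psi α) (Set.Ici 0) :=
  (monotoneOn_phi hα).congr fun _ hx => (psi_eq_phi_of_nonneg hx).symm

theorem hasDerivAt_phi (hα : 1 < α) (x : ℝ) : HasDerivAt (phi α) (α * psi (α - 1) x) x := by
  rw [funext (phi_eq_abs_rpow (by positivity : α ≠ 0)), psi_eq_abs_rpow_mul]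
  convert hasDerivAt_abs_rpow x hα using 1
  ring_nf

theorem hasDerivAt_psi (hα : 1 < α) (x : ℝ) : HasDerivAt (psi α) (α * phi (α - 1) x) x := by
  have hα' : α - 1 ≠ 0 := by linarith
  rw [funext (psi_eq_abs_rpow_mul α), phi_eq_abs_rpow hα']
  by_cases hx : x = 0
  · have factor_isLittleO : (fun y : ℝ => |y| ^ (α - 1)) =o[𝓝 0] fun _ => (1 : ℝ) := by
      refine (Asymptotics.isLittleO_one_iff ℝ).mpr ?_
      have : ContinuousAt (fun y : ℝ => |y| ^ (α - 1)) 0 :=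
        continuous_abs.continuousAt.rpow_const (.inr (by linarith))
      simpa [hα'] using this.tendsto
    rw [hasDerivAt_iff_isLittleO_nhds_zero]
    simpa [hx, hα'] using factor_isLittleO.mul_isBigO (Asymptotics.isBigO_refl id _)
  · have deriv_factor := (hasDerivAt_abs hx).rpow_const (p := α - 1) (.inl (abs_ne_zero.mpr hx))
    refine (deriv_factor.mul (hasDerivAt_id' x)).congr_deriv ?_
    rw [Real.rpow_sub_one (abs_ne_zero.mpr hx) (α - 1)]
    field_simp
    linear_combination (α - 1) * sign_mul_self x

theorem continuous_phi_exponent (x : ℝ) : Continuous fun α => phi α x := by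
  by_cases hx : x = 0
  · simp [phi, hx, continuous_const]
  · simpa [phi, hx] using Real.continuous_const_rpow (abs_ne_zero.mpr hx)

theorem continuous_psi_exponent (x : ℝ) : Continuous fun α => psi α x := by
  by_cases hx : x = 0
  · simp [psi, hx, continuous_const]
  · simpa [psi, hx] using (Real.continuous_const_rpow (abs_ne_zero.mpr hx)).const_mul _

theorem phi_natCast_of_even {p : ℕ} (hp : Even p) (hp₀ : p ≠ 0) : phi p = fun x => x ^ p := by
  ext x
  rw [phi_eq_abs_rpow (Nat.cast_ne_zero.mpr hp₀), Real.rpow_natCast, hp.pow_abs]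

theorem psi_natCast_of_odd {p : ℕ} (hp : Odd p) : psi p = fun x => x ^ p := by
  obtain ⟨k, rfl⟩ := hp
  ext x
  rw [psi_eq_abs_rpow_mul, Nat.cast_add_one, add_sub_cancel_right, Real.rpow_natCast,
    (even_two_mul k).pow_abs, pow_succ]

end SignedPowers

section Sufficiency

variable {α : ℝ} {n : ℕ}

theorem EntrywisePreserver.fin_succ_of_hasDerivAt {f g : ℝ → ℝ} {c : ℝ} (hc : 0 ≤ c)
    (hg : EntrywisePreserver g (Fin n)) (hfg : ∀ x, HasDerivAt f (c * g x) x)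
    (hmul : ∀ x y, f (x * y) = f x * f y) : EntrywisePreserver f (Fin (n + 1)) :=
  (hg.option_of_hasDerivAt hc hfg hmul).of_injective (finSuccEquiv n).injective

theorem entrywisePreserver_phi_psi_of_lt (hα : n < α) :
    EntrywisePreserver (phi α) (Fin (n + 2)) ∧ EntrywisePreserver (psi α) (Fin (n + 2)) := by
  induction n generalizing α with
  | zero =>
    have hα : 0 < α := by simpa using hα
    exact ⟨.fin_two (phi_mul α) (monotoneOn_phi hα), .fin_two (psi_mul α) (monotoneOn_psi hα)⟩
  | succ n ih =>
    push_cast at hα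
    have one_lt : 1 < α := by linarith [Nat.cast_nonneg (α := ℝ) n]
    have nonneg : 0 ≤ α := by linarith
    obtain ⟨phi_pred, psi_pred⟩ := ih (α := α - 1) (by linarith)
    exact ⟨psi_pred.fin_succ_of_hasDerivAt nonneg (hasDerivAt_phi one_lt) (phi_mul α),
      phi_pred.fin_succ_of_hasDerivAt nonneg (hasDerivAt_psi one_lt) (psi_mul α)⟩

theorem entrywisePreserver_phi_psi_of_le (hα : n ≤ α) :
    EntrywisePreserver (phi α) (Fin (n + 2)) ∧ EntrywisePreserver (psi α) (Fin (n + 2)) := by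
  have preserver_of_gt : ∀ᶠ β in 𝓝[>] α,
      EntrywisePreserver (phi β) (Fin (n + 2)) ∧ EntrywisePreserver (psi β) (Fin (n + 2)) :=
    eventually_mem_nhdsWithin.mono fun _ hβ => entrywisePreserver_phi_psi_of_lt (hα.trans_lt hβ)
  exact ⟨.of_tendsto (preserver_of_gt.mono fun _ => And.left)
      fun x => (continuous_phi_exponent x).continuousWithinAt,
    .of_tendsto (preserver_of_gt.mono fun _ => And.right)
      fun x => (continuous_psi_exponent x).continuousWithinAt⟩

theorem entrywisePreserver_phi (hn : 2 ≤ n) (hα : α ∈ phiPowers n) :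
    EntrywisePreserver (phi α) (Fin n) := by
  rcases hα with ⟨k, hk, rfl⟩ | hα
  · have phi_eq := phi_natCast_of_even (even_two_mul k) (by lia)
    push_cast at phi_eq
    exact phi_eq ▸ .pow _
  · obtain ⟨n, rfl⟩ := Nat.exists_eq_add_of_le' hn
    exact (entrywisePreserver_phi_psi_of_le (by simpa using hα)).1

theorem entrywisePreserver_psi (hn : 2 ≤ n) (hα : α ∈ psiPowers n) :
    EntrywisePreserver (psi α) (Fin n) := by
  rcases hα with ⟨k, hk, rfl⟩ | hα
  · obtain ⟨k, rfl⟩ := Nat.exists_eq_add_of_le' hk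
    have exponent_eq : (-1 + 2 * (k + 1 : ℕ) : ℝ) = (2 * k + 1 : ℕ) := by
      push_cast
      ring
    rw [exponent_eq, psi_natCast_of_odd (odd_two_mul_add_one k)]
    exact .pow _
  · obtain ⟨n, rfl⟩ := Nat.exists_eq_add_of_le' hn
    exact (entrywisePreserver_phi_psi_of_le (by simpa using hα)).2

end Sufficiency

section NodalWeights

open Polynomial Lagrange

variable {F ι : Type*} [Field F] [DecidableEq ι] {s : Finset ι} {v : ι → F} {P : F[X]}

theorem sum_nodalWeight_mul_eval (hv : Set.InjOn v s) (hP : P.degree < s.card) :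
    ∑ i ∈ s, nodalWeight s v i * P.eval (v i) = P.coeff (s.card - 1) := by
  simp only [coeff_eq_sum hv hP, nodalWeight, Finset.prod_inv_distrib, div_eq_inv_mul]

theorem sum_nodalWeight_mul_affine_pow (hv : Set.InjOn v s) {p : ℕ} (hp : p + 1 < s.card)
    (a b : F) : ∑ i ∈ s, nodalWeight s v i * (a + b * v i) ^ p = 0 := by
  have natDegree_le : ((C a + C b * X) ^ p).natDegree ≤ p := by compute_degree
  have degree_lt {k : ℕ} (hk : p < k) : ((C a + C b * X) ^ p).degree < (k : WithBot ℕ) :=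
    (natDegree_le_iff_degree_le.mp natDegree_le).trans_lt (by exact_mod_cast hk)
  have sum_eq := sum_nodalWeight_mul_eval hv (degree_lt (by lia))
  rw [coeff_eq_zero_of_degree_lt (degree_lt (by lia))] at sum_eq
  simpa using sum_eq

theorem sum_sum_nodalWeight_mul_eval (hv : Set.InjOn v s) (hP : P.degree < s.card) (ε : F) :
    ∑ i ∈ s, ∑ j ∈ s, nodalWeight s v i * nodalWeight s v j * P.eval (ε * (v i * v j)) =
      P.coeff (s.card - 1) * ε ^ (s.card - 1) := by
  have inner_sum (i) : ∑ j ∈ s, nodalWeight s v j * P.eval (ε * (v i * v j)) =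
      P.coeff (s.card - 1) * ε ^ (s.card - 1) * v i ^ (s.card - 1) := by
    have degree_lt : (P.comp (C (ε * v i) * X)).degree < s.card := by
      refine (degree_lt_iff_coeff_zero _ _).mpr fun k hk => ?_
      rw [comp_C_mul_X_coeff, (degree_lt_iff_coeff_zero _ _).mp hP k hk, zero_mul]
    have sum_eq := sum_nodalWeight_mul_eval hv degree_lt
    rw [comp_C_mul_X_coeff, mul_pow, ← mul_assoc] at sum_eq
    simpa only [eval_comp, eval_mul, eval_C, eval_X, mul_assoc] using sum_eq
  obtain rfl | hs := s.eq_empty_or_nonempty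
  · rw [Finset.card_empty, Nat.cast_zero, Nat.WithBot.lt_zero_iff, degree_eq_bot] at hP
    simp [hP]
  have sum_pow : ∑ i ∈ s, nodalWeight s v i * v i ^ (s.card - 1) = 1 := by
    have degree_lt : (X ^ (s.card - 1) : F[X]).degree < s.card := by
      rw [degree_X_pow]
      exact_mod_cast Nat.sub_one_lt hs.card_ne_zero
    simpa using sum_nodalWeight_mul_eval hv degree_lt
  calc ∑ i ∈ s, ∑ j ∈ s, nodalWeight s v i * nodalWeight s v j * P.eval (ε * (v i * v j))
    _ = ∑ i ∈ s, nodalWeight s v i *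
          (P.coeff (s.card - 1) * ε ^ (s.card - 1) * v i ^ (s.card - 1)) := by
      simp only [← inner_sum, Finset.mul_sum, mul_assoc]
    _ = P.coeff (s.card - 1) * ε ^ (s.card - 1) *
          ∑ i ∈ s, nodalWeight s v i * v i ^ (s.card - 1) := by
      simp only [Finset.mul_sum, mul_left_comm]
    _ = P.coeff (s.card - 1) * ε ^ (s.card - 1) := by rw [sum_pow, mul_one]

end NodalWeights

section Horn

open Polynomial Lagrange
open scoped Nat

theorem exists_taylor_polynomial_isLittleO {f : ℝ → ℝ} {a : ℝ} {N : ℕ} (hf : ContDiffAt ℝ N f a) :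
    ∃ T : ℝ[X], T.natDegree ≤ N ∧ T.coeff N = iteratedDeriv N f a / N ! ∧
      (fun h => f (a + h) - T.eval h) =o[𝓝 0] fun h => h ^ N := by
  obtain ⟨u, hu, hfu⟩ := hf.contDiffOn le_rfl (by simp)
  obtain ⟨r, hr, hru⟩ := Metric.mem_nhds_iff.mp hu
  refine ⟨∑ k ∈ Finset.range (N + 1), monomial k (iteratedDeriv k f a / k !), ?_, ?_, ?_⟩
  · refine natDegree_sum_le_of_forall_le _ _ fun k hk => ?_
    exact (natDegree_monomial_le _).trans (Nat.lt_succ_iff.mp (Finset.mem_range.mp hk))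
  · simp [coeff_monomial]
  · have taylor := taylor_isLittleO (convex_ball a r) (Metric.mem_ball_self hr) (hfu.mono hru)
    rw [Metric.isOpen_ball.nhdsWithin_eq (Metric.mem_ball_self hr)] at taylor
    have tendsto_add : Tendsto (fun h => a + h) (𝓝 0) (𝓝 a) := by
      simpa using (continuous_const_add a).tendsto 0
    refine (taylor.comp_tendsto tendsto_add).congr (fun h => ?_) (fun h => by simp)
    simp only [Function.comp_apply, taylor_within_apply, eval_finsetSum, eval_monomial,
      add_sub_cancel_left, smul_eq_mul]
    congr 1
    refine Finset.sum_congr rfl fun k _ => ?_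
    rw [iteratedDerivWithin_of_isOpen Metric.isOpen_ball (Metric.mem_ball_self hr)]
    ring

-- The weights annihilate all powers below the `N`-th, so only one Taylor coefficient survives.
theorem tendsto_nodalWeight_quadForm_div_pow {f : ℝ → ℝ} {N : ℕ} {a : ℝ}
    (hf : ContDiffAt ℝ N f a) {y : Fin (N + 1) → ℝ} (hy : Function.Injective y) :
    Tendsto (fun ε => (∑ i, ∑ j, nodalWeight Finset.univ y i * nodalWeight Finset.univ y j *
      f (a + ε * (y i * y j))) / ε ^ N) (𝓝[≠] 0) (𝓝 (iteratedDeriv N f a / N !)) := by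
  obtain ⟨T, T_degree, T_coeff, remainder_isLittleO⟩ := exists_taylor_polynomial_isLittleO hf
  set w : Fin (N + 1) → ℝ := nodalWeight Finset.univ y
  have taylor_part (ε : ℝ) : ∑ i, ∑ j, w i * w j * T.eval (ε * (y i * y j)) =
      iteratedDeriv N f a / N ! * ε ^ N := by
    have degree_lt : T.degree < (Finset.univ : Finset (Fin (N + 1))).card := by
      rw [Finset.card_fin]
      exact (natDegree_le_iff_degree_le.mp T_degree).trans_lt (by exact_mod_cast N.lt_succ_self)
    simpa [T_coeff] using sum_sum_nodalWeight_mul_eval hy.injOn degree_lt ε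
  have entry_isLittleO (i j) : (fun ε => w i * w j *
      (f (a + ε * (y i * y j)) - T.eval (ε * (y i * y j)))) =o[𝓝 0] fun ε => ε ^ N := by
    have tendsto_zero : Tendsto (fun ε => ε * (y i * y j)) (𝓝 0) (𝓝 0) := by
      simpa using (continuous_mul_const (y i * y j)).tendsto 0
    refine ((remainder_isLittleO.comp_tendsto tendsto_zero).const_mul_left _).trans_isBigO ?_
    refine .of_bound (|y i * y j| ^ N) (.of_forall fun ε => ?_)
    simp [abs_mul, mul_pow, mul_comm]
  have total_isLittleO : (fun ε => ∑ i, ∑ j, w i * w j * f (a + ε * (y i * y j)) -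
      iteratedDeriv N f a / N ! * ε ^ N) =o[𝓝 0] fun ε => ε ^ N := by
    simp only [← taylor_part, ← Finset.sum_sub_distrib, ← mul_sub]
    exact .fun_sum fun i _ => .fun_sum fun j _ => entry_isLittleO i j
  refine tendsto_sub_nhds_zero_iff.mp ?_
  refine (total_isLittleO.mono nhdsWithin_le_nhds).tendsto_div_nhds_zero.congr' ?_
  filter_upwards [self_mem_nhdsWithin] with ε (hε : ε ≠ 0)
  rw [sub_div, mul_div_cancel_right₀ _ (pow_ne_zero N hε)]

theorem EntrywisePreserver.iteratedDeriv_nonneg {f : ℝ → ℝ} {N : ℕ} {a : ℝ}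
    (hf : EntrywisePreserver f (Fin (N + 1))) (ha : 0 ≤ a) (hfa : ContDiffAt ℝ N f a) :
    0 ≤ iteratedDeriv N f a := by
  let y : Fin (N + 1) → ℝ := fun i => i
  have y_inj : Function.Injective y := Nat.cast_injective.comp Fin.val_injective
  have quotient_tendsto :=
    (tendsto_nodalWeight_quadForm_div_pow hfa y_inj).mono_left (nhdsGT_le_nhdsNE 0)
  have limit_nonneg : 0 ≤ iteratedDeriv N f a / N ! := by
    refine ge_of_tendsto quotient_tendsto ?_
    filter_upwards [self_mem_nhdsWithin] with ε (hε : 0 < ε)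
    have test_pos : (a • vecMulVec 1 (star 1) + ε • vecMulVec y (star y)).PosSemidef :=
      ((posSemidef_vecMulVec_self_star 1).smul ha).add
        ((posSemidef_vecMulVec_self_star y).smul hε.le)
    have quad_nonneg := (posSemidef_iff_sum_sum_nonneg.mp (hf _ test_pos)).2
      (nodalWeight Finset.univ y)
    refine div_nonneg ?_ (by positivity)
    simpa [vecMulVec_apply] using quad_nonneg
  simpa using (le_div_iff₀ (by positivity)).mp limit_nonneg

end Horn

section Necessity

open Polynomial Lagrange

variable {f : ℝ → ℝ} {α : ℝ} {n : ℕ}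

theorem EntrywisePreserver.descPochhammer_eval_nonneg {N : ℕ}
    (hf : EntrywisePreserver f (Fin (N + 1))) (hfα : ∀ x, 0 < x → f x = x ^ α) :
    0 ≤ (descPochhammer ℝ N).eval α := by
  have f_eventuallyEq : f =ᶠ[𝓝 1] fun x => x ^ α := by
    filter_upwards [lt_mem_nhds one_pos] with x hx using hfα x hx
  have contDiffAt : ContDiffAt ℝ N f 1 :=
    (Real.contDiffAt_rpow_const_of_ne one_ne_zero).congr_of_eventuallyEq f_eventuallyEq
  have deriv_nonneg := hf.iteratedDeriv_nonneg zero_le_one contDiffAt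
  rw [f_eventuallyEq.iteratedDeriv_eq, iteratedDeriv_eq_iterate,
    Real.iter_deriv_rpow_const] at deriv_nonneg
  simpa using deriv_nonneg

theorem EntrywisePreserver.exists_natCast_eq_of_lt (hn : 2 ≤ n)
    (hf : EntrywisePreserver f (Fin n)) (hfα : ∀ x, 0 < x → f x = x ^ α) (hα : α < n - 2) :
    ∃ p : ℕ, α = p ∧ p + 3 ≤ n := by
  have descPochhammer_nonneg {N : ℕ} (hN : N + 1 ≤ n) : 0 ≤ (descPochhammer ℝ N).eval α :=
    (hf.of_injective (Fin.castLE_injective hN)).descPochhammer_eval_nonneg hfα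
  have α_nonneg : 0 ≤ α := by simpa using descPochhammer_nonneg hn
  have floor_le : ⌊α⌋₊ + 3 ≤ n := by
    have : ((⌊α⌋₊ + 2 : ℕ) : ℝ) < n := by
      push_cast
      linarith [Nat.floor_le α_nonneg]
    exact_mod_cast this
  refine ⟨⌊α⌋₊, (Nat.floor_le α_nonneg).antisymm' ?_, floor_le⟩
  -- The last factor `α - (⌊α⌋ + 1)` of the falling factorial is negative.
  have product_nonneg := descPochhammer_nonneg floor_le
  rw [descPochhammer_succ_right, eval_mul] at product_nonneg
  by_contra! floor_lt
  have pos : 0 < (descPochhammer ℝ (⌊α⌋₊ + 1)).eval α :=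
    descPochhammer_pos (by simpa using floor_lt)
  have neg : (X - ((⌊α⌋₊ + 1 : ℕ) : ℝ[X])).eval α < 0 := by
    simpa [sub_neg] using Nat.lt_floor_add_one α
  exact (mul_neg_of_pos_of_neg pos neg).not_ge product_nonneg

theorem EntrywisePreserver.sum_mul_eq_zero {ι : Type*} [Fintype ι]
    (hf : EntrywisePreserver f (Option ι)) {y w : ι → ℝ} {c : ℝ} (hc : 0 ≤ c)
    (hw : ∀ i, ∑ j, f (c + y i * y j) * w j = 0) : ∑ j, f (y j) * w j = 0 := by
  let a (o : Option ι) : ℝ := o.elim 0 1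
  let b (o : Option ι) : ℝ := o.elim 1 y
  let x (o : Option ι) : ℝ := o.elim 0 w
  let A := c • vecMulVec a (star a) + vecMulVec b (star b)
  have fA_pos : (A.map f).PosSemidef :=
    hf A (((posSemidef_vecMulVec_self_star a).smul hc).add (posSemidef_vecMulVec_self_star b))
  have quad_eq_zero : star x ⬝ᵥ (A.map f *ᵥ x) = 0 := by
    simp [dotProduct, mulVec, Fintype.sum_option, A, a, b, x, vecMulVec_apply, hw]
  have kernel := congrFun ((fA_pos.dotProduct_mulVec_zero_iff x).mp quad_eq_zero) none
  simpa [dotProduct, mulVec, Fintype.sum_option, A, a, b, x, vecMulVec_apply] using kernel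

theorem not_entrywisePreserver_of_sign_change {p : ℕ} (hpos : ∀ x, 0 < x → f x = x ^ p)
    (hneg : ∀ x < 0, f x = -x ^ p) : ¬ EntrywisePreserver f (Fin (p + 3)) := by
  intro hf
  let y (i : Fin (p + 2)) : ℝ := i - 1 / 2
  let w : Fin (p + 2) → ℝ := nodalWeight Finset.univ y
  have y_inj : Function.Injective y := fun i j h => by simpa [y, Fin.ext_iff] using h
  have sum_eq_zero (a b : ℝ) : ∑ j, (a + b * y j) ^ p * w j = 0 := by
    simpa only [w, mul_comm] using sum_nodalWeight_mul_affine_pow y_inj.injOn (by simp) a b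
  have y_mul_pos (i j) : 0 < ((p + 2) ^ 2 : ℝ) + y i * y j := by
    have abs_le (i) : |y i| ≤ p + 1 := by
      have : (i : ℝ) ≤ p + 1 := by exact_mod_cast Fin.is_le i
      rw [abs_le]
      constructor <;> simp only [y] <;> linarith [Nat.cast_nonneg (α := ℝ) i]
    have := mul_le_mul (abs_le i) (abs_le j) (abs_nonneg _) (by positivity)
    rw [← abs_mul] at this
    nlinarith [neg_abs_le (y i * y j)]
  have sum_f_eq_zero : ∑ j, f (y j) * w j = 0 := by
    have hf' := hf.of_injective (finSuccEquiv (p + 2)).symm.injective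
    refine hf'.sum_mul_eq_zero (sq_nonneg (p + 2 : ℝ)) fun i => ?_
    simpa only [hpos _ (y_mul_pos i _)] using sum_eq_zero _ (y i)
  have y_zero_neg : y 0 < 0 := by norm_num [y]
  have y_succ_pos (j : Fin (p + 1)) : 0 < y j.succ := by
    simp [y]
    linarith [Nat.cast_nonneg (α := ℝ) j]
  have sum_pow_eq_zero : ∑ j, y j ^ p * w j = 0 := by simpa using sum_eq_zero 0 1
  rw [Fin.sum_univ_succ] at sum_f_eq_zero sum_pow_eq_zero
  simp only [hneg _ y_zero_neg, hpos _ (y_succ_pos _)] at sum_f_eq_zero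
  have term_eq_zero : y 0 ^ p * w 0 = 0 := by linarith
  exact mul_ne_zero (pow_ne_zero p y_zero_neg.ne)
    (nodalWeight_ne_zero y_inj.injOn (Finset.mem_univ 0)) term_eq_zero

theorem not_entrywisePreserver_phi_zero : ¬ EntrywisePreserver (phi 0) (Fin 3) := by
  intro h
  have A_pos : (vecMulVec ![1, 1, 0] (star ![1, 1, 0]) +
      vecMulVec ![0, 1, 1] (star ![(0 : ℝ), 1, 1])).PosSemidef :=
    (posSemidef_vecMulVec_self_star _).add (posSemidef_vecMulVec_self_star _)
  have quad_nonneg := (posSemidef_iff_sum_sum_nonneg.mp (h _ A_pos)).2 ![1, -1, 1]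
  simp [Fin.sum_univ_three, phi] at quad_nonneg
  norm_num at quad_nonneg

theorem entrywisePreserver_phi_iff (hn : 2 ≤ n) :
    EntrywisePreserver (phi α) (Fin n) ↔ α ∈ phiPowers n := by
  refine ⟨fun h => ?_, entrywisePreserver_phi hn⟩
  by_contra hα
  simp only [phiPowers, Set.mem_union, not_or, Set.mem_Ici, not_le] at hα
  obtain ⟨p, rfl, hp⟩ := h.exists_natCast_eq_of_lt hn (fun x => phi_of_pos) hα.2
  have odd_or_zero : Odd p ∨ p = 0 := by
    by_contra! hp
    obtain ⟨k, rfl⟩ := even_iff_two_dvd.mp (Nat.not_odd_iff_even.mp hp.1)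
    exact hα.1 ⟨k, by lia, by push_cast; rfl⟩
  have h' := h.of_injective (Fin.castLE_injective hp)
  rcases odd_or_zero with odd | rfl
  · refine not_entrywisePreserver_of_sign_change (p := p) (fun x hx => ?_) (fun x hx => ?_) h'
    · rw [phi_of_pos hx, Real.rpow_natCast]
    · rw [← phi_neg, phi_of_pos (neg_pos.mpr hx), Real.rpow_natCast, odd.neg_pow]
  · exact not_entrywisePreserver_phi_zero (by simpa using h')

theorem entrywisePreserver_psi_iff (hn : 2 ≤ n) :
    EntrywisePreserver (psi α) (Fin n) ↔ α ∈ psiPowers n := by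
  refine ⟨fun h => ?_, entrywisePreserver_psi hn⟩
  by_contra hα
  simp only [psiPowers, Set.mem_union, not_or, Set.mem_Ici, not_le] at hα
  obtain ⟨p, rfl, hp⟩ := h.exists_natCast_eq_of_lt hn (fun x => psi_of_pos) hα.2
  have even : Even p := by
    by_contra hp
    obtain ⟨k, rfl⟩ := Nat.not_even_iff_odd.mp hp
    exact hα.1 ⟨k + 1, by lia, by push_cast; ring⟩
  refine not_entrywisePreserver_of_sign_change (p := p) (fun x hx => ?_) (fun x hx => ?_)
    (h.of_injective (Fin.castLE_injective hp))
  · rw [psi_of_pos hx, Real.rpow_natCast]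
  · rw [← neg_neg x, psi_neg, psi_of_pos (neg_pos.mpr hx), Real.rpow_natCast, neg_neg, even.neg_pow]

end Necessity

section SimultaneousDiagonalization

open Polynomial

variable {ι κ 𝕜 : Type*} [RCLike 𝕜]

theorem cfc_apply_algHom_pi {A : Type*} [Ring A] [StarRing A] [TopologicalSpace A] [Algebra ℝ A]
    {P : A → Prop} [ContinuousFunctionalCalculus ℝ A P] [Finite κ] (φ : (κ → ℝ) →ₐ[ℝ] A)
    {d : κ → ℝ} (hd : P (φ d)) (f : ℝ → ℝ) : cfc f (φ d) = φ (f ∘ d) := by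
  classical
  have := Fintype.ofFinite κ
  set q := Lagrange.interpolate (Finset.univ.image d) id f
  have eval_eq (a) : q.eval (d a) = f (d a) :=
    Lagrange.eval_interpolate_at_node (v := id) f Function.injective_id.injOn (by simp)
  have eqOn_spectrum : (spectrum ℝ (φ d)).EqOn f q.eval := by
    refine Set.EqOn.mono (AlgHom.spectrum_apply_subset φ d) fun x hx => ?_
    rw [Pi.spectrum_eq, Set.mem_iUnion] at hx
    obtain ⟨a, ha⟩ := hx
    obtain rfl : x = d a := (spectrum.scalar_eq (A := ℝ) (d a)).subset ha
    exact (eval_eq a).symm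
  rw [cfc_congr eqOn_spectrum, cfc_polynomial q _ hd, aeval_algHom_apply, aeval_pi_apply]
  simp only [coe_aeval_eq_eval, eval_eq, Function.comp_def]

open scoped Function in
theorem exists_orthonormalBasis_forall_apply_eq_smul {E : Type*} [NormedAddCommGroup E]
    [InnerProductSpace 𝕜 E] [FiniteDimensional 𝕜 E] [Fintype κ]
    (hκ : Module.finrank 𝕜 E = Fintype.card κ) {T : ι → Module.End 𝕜 E}
    (hT : ∀ i, (T i).IsSymmetric) (hcomm : Pairwise (Commute on T)) :
    ∃ (b : OrthonormalBasis κ 𝕜 E) (d : ι → κ → ℝ), ∀ i a, T i (b a) = (d i a : 𝕜) • b a := by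
  classical
  let V (χ : ι → 𝕜) : Submodule 𝕜 E := ⨅ i, Module.End.eigenspace (T i) (χ i)
  have internal := LinearMap.IsSymmetric.directSum_isInternal_of_pairwise_commute hT hcomm
  have : Finite {χ // V χ ≠ ⊥} :=
    (WellFoundedGT.finite_ne_bot_of_iSupIndep internal.submodule_iSupIndep).to_subtype
  have := Fintype.ofFinite {χ // V χ ≠ ⊥}
  have internal_ne_bot := DirectSum.isInternal_ne_bot_iff.mpr internal
  have orthogonal : OrthogonalFamily 𝕜 (fun χ : {χ // V χ ≠ ⊥} => V χ) fun χ => (V χ).subtypeₗᵢ :=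
    (LinearMap.IsSymmetric.orthogonalFamily_iInf_eigenspaces hT).comp Subtype.val_injective
  let b₀ := internal_ne_bot.subordinateOrthonormalBasis hκ orthogonal
  let χ (a) : ι → 𝕜 := (internal_ne_bot.subordinateOrthonormalBasisIndex hκ a orthogonal).1
  have hasEigenvector (a i) : (T i).HasEigenvector (χ a i) (b₀ a) :=
    ⟨Submodule.mem_iInf _ |>.mp
      (internal_ne_bot.subordinateOrthonormalBasis_subordinate hκ a orthogonal) i,
      b₀.orthonormal.ne_zero a⟩
  let e := (Fintype.equivFin κ).symm
  refine ⟨b₀.reindex e, fun i a => RCLike.re (χ (e.symm a) i), fun i a => ?_⟩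
  have eigenvalue_real : ((RCLike.re (χ (e.symm a) i) : ℝ) : 𝕜) = χ (e.symm a) i :=
    RCLike.conj_eq_iff_re.mp ((hT i).conj_eigenvalue_eq_self
      (Module.End.hasEigenvalue_of_hasEigenvector (hasEigenvector _ _)))
  rw [eigenvalue_real, b₀.reindex_apply]
  exact (hasEigenvector _ _).apply_eq_smul

variable [Fintype κ] [DecidableEq κ]

/-- The real algebra `U D U*` of matrices with real spectrum diagonalized by the unitary `U`,
parametrized by the diagonal of `D`. -/
noncomputable def unitaryDiagonalHom (U : unitaryGroup κ 𝕜) : (κ → ℝ) →ₐ[ℝ] Matrix κ κ 𝕜 :=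
  (Unitary.conjStarAlgAut ℝ _ U : Matrix κ κ 𝕜 →ₐ[ℝ] Matrix κ κ 𝕜).comp
    ((diagonalAlgHom ℝ).comp ((Algebra.ofId ℝ 𝕜).compLeft κ))

theorem unitaryDiagonalHom_apply (U : unitaryGroup κ 𝕜) (d : κ → ℝ) :
    unitaryDiagonalHom U d = U * diagonal (fun a => (d a : 𝕜)) * star (U : Matrix κ κ 𝕜) := rfl

theorem isHermitian_unitaryDiagonalHom (U : unitaryGroup κ 𝕜) (d : κ → ℝ) :
    (unitaryDiagonalHom U d).IsHermitian := by
  refine isHermitian_mul_mul_conjTranspose _ (isHermitian_diagonal_iff.mpr fun a => ?_)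
  exact RCLike.conj_ofReal _

theorem cfc_unitaryDiagonalHom (U : unitaryGroup κ 𝕜) (d : κ → ℝ) (f : ℝ → ℝ) :
    cfc f (unitaryDiagonalHom U d) = unitaryDiagonalHom U (f ∘ d) :=
  cfc_apply_algHom_pi _ (isHermitian_unitaryDiagonalHom U d).isSelfAdjoint f

theorem exists_forall_eq_unitaryDiagonalHom {A : ι → Matrix κ κ 𝕜} (hA : ∀ i, (A i).IsHermitian)
    (hcomm : ∀ i j, Commute (A i) (A j)) :
    ∃ (U : unitaryGroup κ 𝕜) (d : ι → κ → ℝ), ∀ i, A i = unitaryDiagonalHom U (d i) := by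
  obtain ⟨b, d, hbd⟩ := exists_orthonormalBasis_forall_apply_eq_smul (κ := κ) (by simp)
    (T := fun i => toLpLinAlgEquiv 2 (A i)) (fun i => isSymmetric_toEuclideanLin_iff.mpr (hA i))
    fun i j _ => (hcomm i j).map (toLpLinAlgEquiv 2)
  let U : unitaryGroup κ 𝕜 := ⟨(EuclideanSpace.basisFun κ 𝕜).toBasis.toMatrix b,
    (EuclideanSpace.basisFun κ 𝕜).toMatrix_orthonormalBasis_mem_unitary b⟩
  refine ⟨U, d, fun i => ?_⟩
  have mul_eq : A i * (U : Matrix κ κ 𝕜) = U * diagonal fun a => (d i a : 𝕜) := by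
    ext k a
    rw [mul_diagonal]
    have := congrArg (fun v => v.ofLp k) (hbd i a)
    simpa [toLpLin_apply, mulVec, dotProduct, Matrix.mul_apply, U, Module.Basis.toMatrix_apply,
      mul_comm, RCLike.real_smul_eq_coe_mul] using this
  rw [unitaryDiagonalHom_apply, ← mul_eq, mul_assoc, Unitary.mul_star_self_of_mem U.2, mul_one]

end SimultaneousDiagonalization

section BlockMatrices

variable {ι κ 𝕜 : Type*} [Finite ι] [Fintype κ] [DecidableEq κ] [RCLike 𝕜]

theorem posSemidef_comp_unitaryDiagonalHom_iff {U : unitaryGroup κ 𝕜} {d : ι → ι → κ → ℝ} :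
    (comp ι ι κ κ 𝕜 (of fun s t => unitaryDiagonalHom U (d s t))).PosSemidef ↔
      ∀ a, (of fun s t => d s t a).PosSemidef := by
  classical
  have := Fintype.ofFinite ι
  let W : unitaryGroup (ι × κ) 𝕜 :=
    ⟨kroneckerMap (· * ·) 1 U, kronecker_mem_unitary (one_mem _) U.2⟩
  have comp_eq : comp ι ι κ κ 𝕜 (of fun s t => unitaryDiagonalHom U (d s t)) =
      (W : Matrix (ι × κ) (ι × κ) 𝕜) *
        blockDiagonal (fun a => (of fun s t => d s t a).map ((↑) : ℝ → 𝕜)) *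
        star (W : Matrix (ι × κ) (ι × κ) 𝕜) := by
    ext ⟨s, i⟩ ⟨t, j⟩
    simp only [unitaryDiagonalHom_apply, comp_apply, of_apply, W, Matrix.mul_apply,
      Fintype.sum_prod_type, kroneckerMap_apply, blockDiagonal_apply, star_apply, one_apply,
      map_apply, diagonal_apply]
    simp [apply_ite (starRingEnd 𝕜)]
  rw [comp_eq, (Unitary.isUnit_coe (U := W)).posSemidef_star_right_conjugate_iff,
    posSemidef_blockDiagonal_iff]
  exact forall_congr' fun a => posSemidef_map_ofReal_iff

theorem forall_posSemidef_blockMap_iff (𝕜 : Type*) [RCLike 𝕜] {f : ℝ → ℝ} {m n : ℕ} (hm : 0 < m) :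
    (∀ H : Matrix (Fin n) (Fin n) (Matrix (Fin m) (Fin m) 𝕜), HermitianCommutingBlocks H →
      (flatten H).PosSemidef → (flatten (blockMap f H)).PosSemidef) ↔
      EntrywisePreserver f (Fin n) := by
  have blockMap_eq (U : unitaryGroup (Fin m) 𝕜) (d : Fin n → Fin n → Fin m → ℝ) :
      blockMap f (of fun s t => unitaryDiagonalHom U (d s t)) =
        of fun s t => unitaryDiagonalHom U (f ∘ d s t) :=
    ext fun s t => cfc_unitaryDiagonalHom U (d s t) f
  constructor
  · intro h A hA
    let H : Matrix (Fin n) (Fin n) (Matrix (Fin m) (Fin m) 𝕜) :=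
      of fun s t => unitaryDiagonalHom 1 fun _ => A s t
    have H_commuting : HermitianCommutingBlocks H :=
      ⟨fun _ _ => isHermitian_unitaryDiagonalHom _ _,
        fun _ _ _ _ => (Commute.all _ _).map (unitaryDiagonalHom 1)⟩
    have fH_pos := h H H_commuting (posSemidef_comp_unitaryDiagonalHom_iff.mpr fun _ => hA)
    rw [blockMap_eq] at fH_pos
    exact posSemidef_comp_unitaryDiagonalHom_iff.mp fH_pos ⟨0, hm⟩
  · intro hf H hH hpos
    obtain ⟨U, d, hd⟩ := exists_forall_eq_unitaryDiagonalHom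
      (A := fun st : Fin n × Fin n => H st.1 st.2) (fun _ => hH.1 _ _) fun _ _ => hH.2 _ _ _ _
    obtain rfl : H = of fun s t => unitaryDiagonalHom U (d (s, t)) := ext fun s t => hd (s, t)
    rw [blockMap_eq]
    exact posSemidef_comp_unitaryDiagonalHom_iff.mpr fun a =>
      hf _ (posSemidef_comp_unitaryDiagonalHom_iff.mp hpos a)

end BlockMatrices

theorem mainTheorem6_general (𝕜 : Type*) [RCLike 𝕜] (α : ℝ) {m n : ℕ} (hm : 0 < m) (hn : 2 ≤ n) :
    ((∀ H : Matrix (Fin n) (Fin n) (Matrix (Fin m) (Fin m) 𝕜),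
        HermitianCommutingBlocks H → (flatten H).PosSemidef →
        (flatten (blockMap (phi α) H)).PosSemidef) ↔ α ∈ phiPowers n) ∧
    ((∀ H : Matrix (Fin n) (Fin n) (Matrix (Fin m) (Fin m) 𝕜),
        HermitianCommutingBlocks H → (flatten H).PosSemidef →
        (flatten (blockMap (psi α) H)).PosSemidef) ↔ α ∈ psiPowers n) :=
  ⟨(forall_posSemidef_blockMap_iff 𝕜 hm).trans (entrywisePreserver_phi_iff hn),
    (forall_posSemidef_blockMap_iff 𝕜 hm).trans (entrywisePreserver_psi_iff hn)⟩

theorem mainTheorem6 (α : ℝ) (hα : α ≠ 0) (m n : ℕ) (hm : 2 ≤ m) (hn : 2 ≤ n) :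
    (((∀ H : Matrix (Fin n) (Fin n) (Matrix (Fin m) (Fin m) ℂ),
          HermitianCommutingBlocks H → (flatten H).PosSemidef →
          (flatten (blockMap (phi α) H)).PosSemidef) ↔ α ∈ phiPowers n) ∧
      (α ∉ phiPowers n →
        ∃ H : Matrix (Fin n) (Fin n) (Matrix (Fin m) (Fin m) ℝ),
          HermitianCommutingBlocks H ∧ (flatten H).PosSemidef ∧
          ¬ (flatten (blockMap (phi α) H)).PosSemidef)) ∧
    (((∀ H : Matrix (Fin n) (Fin n) (Matrix (Fin m) (Fin m) ℂ),
          HermitianCommutingBlocks H → (flatten H).PosSemidef →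
          (flatten (blockMap (psi α) H)).PosSemidef) ↔ α ∈ psiPowers n) ∧
      (α ∉ psiPowers n →
        ∃ H : Matrix (Fin n) (Fin n) (Matrix (Fin m) (Fin m) ℝ),
          HermitianCommutingBlocks H ∧ (flatten H).PosSemidef ∧
          ¬ (flatten (blockMap (psi α) H)).PosSemidef)) := by
  have hm₀ : 0 < m := by lia
  obtain ⟨phi_complex, psi_complex⟩ := mainTheorem6_general ℂ α hm₀ hn
  obtain ⟨phi_real, psi_real⟩ := mainTheorem6_general ℝ α hm₀ hn
  exact ⟨⟨phi_complex, by simpa only [not_forall, exists_prop] using mt phi_real.mp⟩,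
    psi_complex, by simpa only [not_forall, exists_prop] using mt psi_real.mp⟩
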